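/- Let $\mathcal B,\mathcal K$ be finite sets (base stations, users) and $L\in\mathbb N$. Data: channels $h_{b,k}\in\mathbb C^L$, $h_k=(h_{b,k})_{b}$; sets $\mathcal K_b^p,\mathcal K_b^c\subseteq\mathcal K$ (served users); sets $\mathcal M_i\subseteq\mathcal K$ (users decoding the common message of $i$), $\mathcal I_k=\{j: k\in\mathcal M_j\}$; decoding orders $\pi_k:\mathcal K\to\mathbb N$, $\mathcal I'_{i,k}=\{m\in\mathcal I_k:\pi_k(m)>\pi_k(i)\}$; constants $C_b^{\max}\ge 0$, $P_b^{\max}>0$, $\tau>0$, $\sigma>0$, $\alpha\in[0,1]$, $r_k^{\mathrm{des}}\in\mathbb R$. Variables: precoders $w=(w_{b,k}^o)$, $w_{b,k}^o\in\mathbb C^L$, with $w_{b,k}^o=0$ if $k\notin\mathcal K_b^o$ ($o\in\{p,c\}$), $w_k^o=(w_{b,k}^o)_b$, and real rates $r=(r_k^p,r_k^c)$. Put $$D_k^p(w)=\sum_{j\ne k}|h_k^Hw_j^p|^2+\sum_{l\notin\mathcal I_k}|h_k^Hw_l^c|^2+\sigma^2,\qquad D_{i,k}^c(w)=\sum_{j\in\mathcal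 K}|h_k^Hw_j^p|^2+\sum_{l\in(\mathcal K\setminus\mathcal I_k)\cup\mathcal I'_{i,k}}|h_k^Hw_l^c|^2+\sigma^2,$$ $\Gamma_k^p=|h_k^Hw_k^p|^2/D_k^p$, $\Gamma_{i,k}^c=|h_k^Hw_i^c|^2/D_{i,k}^c$, and $$\Psi(w,r)=\frac{\alpha}{|\mathcal K|}\sum_k|r_k^p+r_k^c-r_k^{\mathrm{des}}|^2+(1-\alpha)\sum_k\big(\|w_k^p\|_2^2+\|w_k^c\|_2^2\big).$$ Problem (Opt1): minimize $\Psi(w,r)$ subject to, for all $b$, (F) $\sum_{k\in\mathcal K_b^p}r_k^p+\sum_{k\in\mathcal K_b^c}r_k^c\le C_b^{\max}$, (P) $\sum_{k\in\mathcal K_b^p}\|w_{b,k}^p\|_2^2+\sum_{k\in\mathcal K_b^c}\|w_{b,k}^c\|_2^2\le P_b^{\max}$, and $r_k^p\le\tau\log_2(1+\Gamma_k^p)$ for all $k$, $r_i^c\le\tau\log_2(1+\Gamma_{i,k}^c)$ for all $k$ and $i\in\mathcal I_k$. A stationary solution is a Karush–Kuhn–Tucker point of this problem. Problem (Opt3)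 for given $u_k^p,u_{i,k}^c\in\mathbb C$: minimize $\Psi(w,r)$ over $(w,r,\gamma)$ subject to (F), (P) and, for all $k$ and $i\in\mathcal I_k$, $\gamma_k^p>-1$, $\gamma_{i,k}^c>-1$, $r_k^p\le\tau\log_2(1+\gamma_k^p)$, $r_i^c\le\tau\log_2(1+\gamma_{i,k}^c)$, $$\gamma_k^p-2\,\mathrm{Re}\{(u_k^p)^*(w_k^p)^Hh_k\}+|u_k^p|^2D_k^p(w)\le 0,\qquad \gamma_{i,k}^c-2\,\mathrm{Re}\{(u_{i,k}^c)^*(w_i^c)^Hh_k\}+|u_{i,k}^c|^2D_{i,k}^c(w)\le 0.$$ Algorithm 1: start at precoders $w^0$ satisfying (P); for $n=0,1,\dots$ put $u_k^p=(w_k^{p})^Hh_k/D_k^p(w)$, $u_{i,k}^c=(w_i^{c})^Hh_k/D_{i,k}^c(w)$ at $w=w^n$, and let $(w^{n+1},r^{n+1},\gamma^{n+1})$ be any solution of (Opt3) for this $u$. Claim. (1) For every run of Algorithm 1 the values $\Psi(w^n,r^n)$, $n\ge1$, are nonincreasing and converge, and every cluster point $(w^\star,r^\star)$ of $(w^n,r^n)_n$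 is a stationary solution of (Opt1); in particular, so is the limit whenever the iterates converge. (2) If $\alpha>0$ and every common message is decoded by at least one user ($\mathcal M_i\ne\emptyset$ for all $i$), then (Opt3) has a solution in every iteration (for every $w$ satisfying (P)), and every run has at least one cluster point, which is a stationary solution of (Opt1), and the distance of $(w^n,r^n)$ to the set of stationary solutions of (Opt1) tends to $0$. -/

import Mathlib

open Filter Topology

/-- The (fixed) data of the downlink C-RAN: `ℬ` is the set of base stations, `𝒦` the set of
single-antenna users, `L` the number of antennas per base station. -/
structure Network (ℬ 𝒦 : Type*) [Fintype ℬ] [Fintype 𝒦] (L : ℕ) where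
  /-- `h k b` is the channel vector linking user `k` and base station `b`. -/
  h : 𝒦 → ℬ → EuclideanSpace ℂ (Fin L)
  /-- Users whose private signal is served by base station `b`. -/
  Kp : ℬ → Finset 𝒦
  /-- Users whose common signal is served by base station `b`. -/
  Kc : ℬ → Finset 𝒦
  /-- `M i` is the set of users that decode the common message of user `i`. -/
  M : 𝒦 → Finset 𝒦
  /-- `π k m > π k i` means that user `k` decodes common message `i` before message `m`. -/
  π : 𝒦 → 𝒦 → ℕ
  /-- Fronthaul capacities. -/
  C : ℬ → ℝ
  /-- Maximum transmit powers. -/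
  P : ℬ → ℝ
  /-- Desired rates. -/
  rdes : 𝒦 → ℝ
  /-- Transmission bandwidth. -/
  τ : ℝ
  /-- Noise standard deviation; the noise power is `σ ^ 2`. -/
  σ : ℝ
  /-- Weighting factor between the rate gap and the transmit power. -/
  α : ℝ
  C_nonneg : ∀ b, 0 ≤ C b
  P_pos : ∀ b, 0 < P b
  τ_pos : 0 < τ
  σ_pos : 0 < σ
  α_nonneg : 0 ≤ α
  α_le_one : α ≤ 1

/-- Precoders `(w^p, w^c)`; `w.1 k b` is `w_{b,k}^p` and `w.2 k b` is `w_{b,k}^c`. -/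
abbrev Precoders (ℬ 𝒦 : Type*) (L : ℕ) :=
  (𝒦 → ℬ → EuclideanSpace ℂ (Fin L)) × (𝒦 → ℬ → EuclideanSpace ℂ (Fin L))

/-- Rates `(r^p, r^c)`. -/
abbrev Rates (𝒦 : Type*) := (𝒦 → ℝ) × (𝒦 → ℝ)

/-- SINR variables `(γ^p, γ^c)`; `γ.1 k` is `γ_k^p` and `γ.2 i k` is `γ_{i,k}^c`. -/
abbrev SinrVars (𝒦 : Type*) := (𝒦 → ℝ) × (𝒦 → 𝒦 → ℝ)

/-- Auxiliary variables `(u^p, u^c)`; `u.1 k` is `u_k^p` and `u.2 i k` is `u_{i,k}^c`. -/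
abbrev AuxVars (𝒦 : Type*) := (𝒦 → ℂ) × (𝒦 → 𝒦 → ℂ)

/-- `x^H y` for aggregate vectors `x, y` consisting of one block per base station. -/
noncomputable def herm {ℬ : Type*} [Fintype ℬ] {L : ℕ}
    (x y : ℬ → EuclideanSpace ℂ (Fin L)) : ℂ :=
  ∑ b, inner ℂ (x b) (y b)

/-- Karush-Kuhn-Tucker (stationary) points of the program: minimize `f x` subject to `x ∈ V`
and `c j x ≤ 0` for all `j`, where `V` is a linear subspace. -/
def IsKKTPoint {E ι : Type*} [NormedAddCommGroup E] [NormedSpace ℝ E] [Fintype ι]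
    (V : Submodule ℝ E) (f : E → ℝ) (c : ι → E → ℝ) (x : E) : Prop :=
  x ∈ V ∧ (∀ j, c j x ≤ 0) ∧
  DifferentiableAt ℝ f x ∧ (∀ j, DifferentiableAt ℝ (c j) x) ∧
  ∃ μ : ι → ℝ, (∀ j, 0 ≤ μ j) ∧ (∀ j, μ j * c j x = 0) ∧
    ∀ d ∈ V, fderiv ℝ f x d + ∑ j, μ j * fderiv ℝ (c j) x d = 0

namespace Network

variable {ℬ 𝒦 : Type*} [Fintype ℬ] [Fintype 𝒦] [DecidableEq 𝒦] {L : ℕ}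

/-- `I_k`: the users whose common messages are decoded by user `k`. -/
def I (N : Network ℬ 𝒦 L) (k : 𝒦) : Finset 𝒦 :=
  Finset.univ.filter fun j => k ∈ N.M j

/-- `I'_{i,k}`: the users whose common messages are decoded at user `k` after the one of `i`. -/
def I' (N : Network ℬ 𝒦 L) (i k : 𝒦) : Finset 𝒦 :=
  (N.I k).filter fun m => N.π k i < N.π k m

/-- Interference plus noise at user `k` for its private message. -/
noncomputable def intfP (N : Network ℬ 𝒦 L) (w : Precoders ℬ 𝒦 L) (k : 𝒦) : ℝ :=
  ∑ j ∈ Finset.univ \ {k}, ‖herm (N.h k) (w.1 j)‖ ^ 2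
    + ∑ l ∈ Finset.univ \ N.I k, ‖herm (N.h k) (w.2 l)‖ ^ 2 + N.σ ^ 2

/-- Interference plus noise at user `k` when decoding the common message of user `i`. -/
noncomputable def intfC (N : Network ℬ 𝒦 L) (w : Precoders ℬ 𝒦 L) (i k : 𝒦) : ℝ :=
  ∑ j, ‖herm (N.h k) (w.1 j)‖ ^ 2
    + ∑ l ∈ (Finset.univ \ N.I k) ∪ N.I' i k, ‖herm (N.h k) (w.2 l)‖ ^ 2 + N.σ ^ 2

/-- The SINR `Γ_k^p`. -/
noncomputable def sinrP (N : Network ℬ 𝒦 L) (w : Precoders ℬ 𝒦 L) (k : 𝒦) : ℝ :=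
  ‖herm (N.h k) (w.1 k)‖ ^ 2 / N.intfP w k

/-- The SINR `Γ_{i,k}^c`. -/
noncomputable def sinrC (N : Network ℬ 𝒦 L) (w : Precoders ℬ 𝒦 L) (i k : 𝒦) : ℝ :=
  ‖herm (N.h k) (w.2 i)‖ ^ 2 / N.intfC w i k

/-- The objective `Ψ`: weighted sum of the rate-gap MSE and the transmit power. -/
noncomputable def Ψ (N : Network ℬ 𝒦 L) (x : Precoders ℬ 𝒦 L × Rates 𝒦) : ℝ :=
  N.α * (1 / (Fintype.card 𝒦 : ℝ)) * ∑ k, |x.2.1 k + x.2.2 k - N.rdes k| ^ 2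
    + (1 - N.α) * ∑ k, (∑ b, ‖x.1.1 k b‖ ^ 2 + ∑ b, ‖x.1.2 k b‖ ^ 2)

/-- Left-hand side of the fronthaul constraint of base station `b`. -/
def fronthaulLoad (N : Network ℬ 𝒦 L) (r : Rates 𝒦) (b : ℬ) : ℝ :=
  ∑ k ∈ N.Kp b, r.1 k + ∑ k ∈ N.Kc b, r.2 k

/-- Transmit power of base station `b`. -/
noncomputable def txPower (N : Network ℬ 𝒦 L) (w : Precoders ℬ 𝒦 L) (b : ℬ) : ℝ :=
  ∑ k ∈ N.Kp b, ‖w.1 k b‖ ^ 2 + ∑ k ∈ N.Kc b, ‖w.2 k b‖ ^ 2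

/-- Clustering: `w_{b,k}^o = 0` whenever `k ∉ K_b^o`. -/
def clustered (N : Network ℬ 𝒦 L) : Submodule ℝ (Precoders ℬ 𝒦 L) where
  carrier := {w | (∀ k b, k ∉ N.Kp b → w.1 k b = 0) ∧ (∀ k b, k ∉ N.Kc b → w.2 k b = 0)}
  zero_mem' := ⟨fun _ _ _ => rfl, fun _ _ _ => rfl⟩
  add_mem' := by
    rintro v w ⟨h1, h2⟩ ⟨h3, h4⟩
    exact ⟨fun k b h => by simp [h1 k b h, h3 k b h], fun k b h => by simp [h2 k b h, h4 k b h]⟩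
  smul_mem' := by
    rintro a w ⟨h1, h2⟩
    exact ⟨fun k b h => by simp [h1 k b h], fun k b h => by simp [h2 k b h]⟩

/-- Feasible precoders: clustering and maximum transmit power. -/
def FeasiblePrecoders (N : Network ℬ 𝒦 L) (w : Precoders ℬ 𝒦 L) : Prop :=
  w ∈ N.clustered ∧ ∀ b, N.txPower w b ≤ N.P b

/-! ### The original non-convex problem in the variables `(w, r)` -/

/-- One index per fronthaul constraint, power constraint, private rate constraint, and common
rate constraint (a pair `(i, k)` with `i ∈ I_k`). -/
abbrev Opt1Index (N : Network ℬ 𝒦 L) :=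
  ℬ ⊕ ℬ ⊕ 𝒦 ⊕ {q : 𝒦 × 𝒦 // q.1 ∈ N.I q.2}

/-- The inequality constraints of the original problem, in the form `c j (w, r) ≤ 0`. -/
noncomputable def opt1Constraint (N : Network ℬ 𝒦 L) :
    N.Opt1Index → Precoders ℬ 𝒦 L × Rates 𝒦 → ℝ
  | .inl b, x => N.fronthaulLoad x.2 b - N.C b
  | .inr (.inl b), x => N.txPower x.1 b - N.P b
  | .inr (.inr (.inl k)), x => x.2.1 k - N.τ * Real.logb 2 (1 + N.sinrP x.1 k)
  | .inr (.inr (.inr q)), x =>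
      x.2.2 q.1.1 - N.τ * Real.logb 2 (1 + N.sinrC x.1 q.1.1 q.1.2)

/-- Stationary solutions of the original problem: its Karush-Kuhn-Tucker points. -/
def IsStationaryOpt1 (N : Network ℬ 𝒦 L) (x : Precoders ℬ 𝒦 L × Rates 𝒦) : Prop :=
  IsKKTPoint (N.clustered.prod ⊤) N.Ψ N.opt1Constraint x

/-! ### The quadratic transform and the convex problem for fixed auxiliary variables -/

/-- The function `g^p` of user `k`. -/
noncomputable def gP (N : Network ℬ 𝒦 L) (u : AuxVars 𝒦) (w : Precoders ℬ 𝒦 L)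
    (γ : SinrVars 𝒦) (k : 𝒦) : ℝ :=
  γ.1 k - 2 * (starRingEnd ℂ (u.1 k) * herm (w.1 k) (N.h k)).re
    + ‖u.1 k‖ ^ 2 * N.intfP w k

/-- The function `g^c` of the pair `(i, k)`. -/
noncomputable def gC (N : Network ℬ 𝒦 L) (u : AuxVars 𝒦) (w : Precoders ℬ 𝒦 L)
    (γ : SinrVars 𝒦) (i k : 𝒦) : ℝ :=
  γ.2 i k - 2 * (starRingEnd ℂ (u.2 i k) * herm (w.2 i) (N.h k)).re
    + ‖u.2 i k‖ ^ 2 * N.intfC w i k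

/-- The closed-form update of the auxiliary variables. -/
noncomputable def auxUpdate (N : Network ℬ 𝒦 L) (w : Precoders ℬ 𝒦 L) : AuxVars 𝒦 :=
  (fun k => herm (w.1 k) (N.h k) / (N.intfP w k : ℂ),
   fun i k => herm (w.2 i) (N.h k) / (N.intfC w i k : ℂ))

/-- Feasible set of the convex problem for fixed `u`. The conditions `0 < 1 + γ` are the domain
of the logarithm; `γ_{i,k}^c` is a variable only for `i ∈ I_k` and is `0` otherwise. -/
structure Opt3Feasible (N : Network ℬ 𝒦 L) (u : AuxVars 𝒦) (w : Precoders ℬ 𝒦 L)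
    (r : Rates 𝒦) (γ : SinrVars 𝒦) : Prop where
  clustering : w ∈ N.clustered
  fronthaul : ∀ b, N.fronthaulLoad r b ≤ N.C b
  power : ∀ b, N.txPower w b ≤ N.P b
  gammaP_dom : ∀ k, 0 < 1 + γ.1 k
  gammaC_dom : ∀ k, ∀ i ∈ N.I k, 0 < 1 + γ.2 i k
  gammaC_off : ∀ k, ∀ i ∉ N.I k, γ.2 i k = 0
  rateP : ∀ k, r.1 k ≤ N.τ * Real.logb 2 (1 + γ.1 k)
  rateC : ∀ k, ∀ i ∈ N.I k, r.2 i ≤ N.τ * Real.logb 2 (1 + γ.2 i k)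
  qtP : ∀ k, N.gP u w γ k ≤ 0
  qtC : ∀ k, ∀ i ∈ N.I k, N.gC u w γ i k ≤ 0

/-- `(w, r, γ)` is a (global) solution of the convex problem for fixed `u`. -/
def SolvesOpt3 (N : Network ℬ 𝒦 L) (u : AuxVars 𝒦) (w : Precoders ℬ 𝒦 L)
    (r : Rates 𝒦) (γ : SinrVars 𝒦) : Prop :=
  N.Opt3Feasible u w r γ ∧
  ∀ w' r' γ', N.Opt3Feasible u w' r' γ' → N.Ψ (w, r) ≤ N.Ψ (w', r')

/-- A run of the algorithm: start at feasible precoders `w 0`; iteration `n` computes the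
auxiliary variables from `w n` and then takes a solution `(w, r, γ) (n + 1)` of the convex
problem (any solution, if there are several). The values `r 0` and `γ 0` play no role. -/
structure IsRun (N : Network ℬ 𝒦 L) (w : ℕ → Precoders ℬ 𝒦 L) (r : ℕ → Rates 𝒦)
    (γ : ℕ → SinrVars 𝒦) : Prop where
  init : N.FeasiblePrecoders (w 0)
  step : ∀ n, N.SolvesOpt3 (N.auxUpdate (w n)) (w (n + 1)) (r (n + 1)) (γ (n + 1))

end Network

/-! Completing the square shows that for every `u` the quadratic transform bounds the SINR from
below, with equality when `u` is computed from the same precoders. After eliminating γ, (Opt3) is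
therefore (Opt1) with each SINR replaced by a minorant that is exact at the current precoders. Its
solutions are feasible for (Opt1), and from the second iteration on the previous iterate is feasible
for it. Hence the objective decreases; being nonnegative, it converges.

Let x be a cluster point. Any y that is feasible for the surrogate problem built at x becomes
feasible for the surrogates built at nearby precoders once its rates are lowered by ε. Comparing
with the next iterate, whose value has the same limit, and letting ε tend to 0 shows that x
minimizes its own surrogate (`isStationaryOpt1_of_mapClusterPt`).

Shrinking all precoders and lowering all rates fast enough gives the surrogate a
Mangasarian-Fromovitz direction at x (`exists_slater_direction`), so x is a KKT point of it. A
minorant that touches a function at an interior point has the same gradient there, so values and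
gradients of both sets of constraints agree at x and the multipliers serve (Opt1) as well
(`isStationaryOpt1_of_isMinOn`).

For part (2), power limits bound the precoders and hence the SINRs. This bounds all rates above, and
the rate-gap term bounds them below, so sublevel sets are compact (`isCompact_sublevel`). -/

/-! ### Multipliers and cluster points -/

/-- Gordan's alternative for finitely many linear functionals on a subspace, under a strict
feasibility condition. -/
theorem exists_multipliers_of_slater {E ι : Type*} [AddCommGroup E] [Module ℝ E] [Fintype ι]
    (V : Submodule ℝ E) (f : E →ₗ[ℝ] ℝ) (c : ι → E →ₗ[ℝ] ℝ) {d₀ : E} (hd₀ : d₀ ∈ V)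
    (hc : ∀ j, c j d₀ < 0) (h : ∀ d ∈ V, (∀ j, c j d < 0) → 0 ≤ f d) :
    ∃ μ : ι → ℝ, (∀ j, 0 ≤ μ j) ∧ ∀ d ∈ V, f d + ∑ j, μ j * c j d = 0 := by
  classical
  -- Points strictly above some image (f d, c d), with `none` the coordinate of f. The hypothesis
  -- `h` says exactly that 0 is not among them, and a hyperplane separating 0 from this open convex
  -- set has the multipliers as coefficients.
  let A : Set (Option ι → ℝ) := {a | ∃ d ∈ V, f d < a none ∧ ∀ j, c j d < a (some j)}
  have hAconv : Convex ℝ A := by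
    rintro a ⟨d, hd, h1, h2⟩ b ⟨e, he, h3, h4⟩ s t hs ht hst
    refine ⟨s • d + t • e, V.add_mem (V.smul_mem _ hd) (V.smul_mem _ he), ?_, fun j => ?_⟩
    · simp only [map_add, map_smul, smul_eq_mul, Pi.add_apply, Pi.smul_apply]
      rcases hs.eq_or_lt with rfl | hs
      · obtain rfl : t = 1 := by linarith
        linarith
      · have := mul_lt_mul_of_pos_left h1 hs
        have := mul_le_mul_of_nonneg_left h3.le ht
        linarith
    · simp only [map_add, map_smul, smul_eq_mul, Pi.add_apply, Pi.smul_apply]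
      rcases hs.eq_or_lt with rfl | hs
      · obtain rfl : t = 1 := by linarith
        linarith [h4 j]
      · have := mul_lt_mul_of_pos_left (h2 j) hs
        have := mul_le_mul_of_nonneg_left (h4 j).le ht
        linarith
  have hAopen : IsOpen A := by
    have : A = ⋃ d ∈ V, {a : Option ι → ℝ | f d < a none ∧ ∀ j, c j d < a (some j)} := by
      ext a; simp [A, and_left_comm]
    rw [this]
    refine isOpen_biUnion fun d _ => ?_
    simp only [Set.ofPred_and, Set.ofPred_forall]
    exact (isOpen_lt continuous_const (continuous_apply _)).inter
      (isOpen_iInter_of_finite fun j => isOpen_lt continuous_const (continuous_apply _))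
  have h0 : (0 : Option ι → ℝ) ∉ A := by
    rintro ⟨d, hd, h1, h2⟩
    exact absurd (h d hd h2) (not_le.2 h1)
  obtain ⟨φ, hφ⟩ := geometric_hahn_banach_point_open hAconv hAopen h0
  simp only [map_zero] at hφ
  set l : Option ι → ℝ := fun o => φ (Pi.single o 1) with hl
  have hφl : ∀ a, φ a = l none * a none + ∑ j, l (some j) * a (some j) := by
    intro a
    have := φ.toLinearMap.pi_apply_eq_sum_univ a
    simp only [ContinuousLinearMap.coe_coe, smul_eq_mul, Fintype.sum_option] at this
    rw [this, hl]
    simp only [mul_comm]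
    congr! <;> simp [Pi.single_apply, eq_comm]
  -- Positivity of φ on A passes, as a weak inequality, to the points above the image: raise every
  -- coordinate by ε and let ε tend to 0.
  have key : ∀ d ∈ V, ∀ s : Option ι → ℝ, (∀ o, 0 ≤ s o) →
      0 ≤ l none * (f d + s none) + ∑ j, l (some j) * (c j d + s (some j)) := by
    intro d hd s hs
    have hlim : Tendsto (fun ε : ℝ => φ (fun o => (o.elim (f d) fun j => c j d) + s o + ε))
        (𝓝[>] 0) (𝓝 (φ (fun o => (o.elim (f d) fun j => c j d) + s o + 0))) := by
      refine (φ.continuous.comp (continuous_pi fun o => by fun_prop)).continuousAt.tendsto.mono_left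
        nhdsWithin_le_nhds
    have := ge_of_tendsto hlim (b := 0) <| by
      filter_upwards [self_mem_nhdsWithin] with ε hε
      refine (hφ _ ⟨d, hd, ?_, fun j => ?_⟩).le
      · have := hs none; have : 0 < ε := hε; simp; linarith
      · have := hs (some j); have : 0 < ε := hε; simp; linarith
    simpa [hφl] using this
  have hlnn : ∀ o, 0 ≤ l o := by
    intro o
    have := key 0 V.zero_mem (Pi.single o 1) (fun o' => by
      by_cases h : o' = o
      · subst h; simp
      · simp [h])
    rcases o with _ | i
    · simpa using this
    · simpa [Pi.single_apply] using this
  -- The inequality holds for d and for -d.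
  have heq : ∀ d ∈ V, l none * f d + ∑ j, l (some j) * c j d = 0 := by
    intro d hd
    have h1 := key d hd 0 (fun _ => le_rfl)
    have h2 := key (-d) (V.neg_mem hd) 0 (fun _ => le_rfl)
    simp only [Pi.zero_apply, add_zero, map_neg, mul_neg, Finset.sum_neg_distrib] at h1 h2
    linarith
  -- If the coefficient of f vanished, equality at the Slater direction `d₀` would force all others
  -- to vanish. But φ is positive at the all-ones vector, which lies in A through d = 0.
  have hnone : 0 < l none := by
    refine (hlnn none).lt_of_ne fun h0 => ?_
    have h1 := heq d₀ hd₀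
    rw [← h0, zero_mul, zero_add] at h1
    have h2 := (Finset.sum_eq_zero_iff_of_nonpos fun j _ =>
      mul_nonpos_of_nonneg_of_nonpos (hlnn (some j)) (hc j).le).1 h1
    have h3 : ∀ j, l (some j) = 0 := fun j =>
      (mul_eq_zero.1 (h2 j (Finset.mem_univ j))).resolve_right (hc j).ne
    have h4 := hφ (fun o => (o.elim (f 0) fun j => c j 0) + 1) ⟨0, V.zero_mem, by simp, by simp⟩
    rw [hφl] at h4
    simp [← h0, h3] at h4
  refine ⟨fun j => l (some j) / l none, fun j => div_nonneg (hlnn _) hnone.le, fun d hd => ?_⟩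
  have h1 := heq d hd
  have : f d + ∑ j, l (some j) / l none * c j d
      = (l none * f d + ∑ j, l (some j) * c j d) / l none := by
    rw [add_div, mul_div_cancel_left₀ _ hnone.ne', Finset.sum_div]
    congr 1
    exact Finset.sum_congr rfl fun j _ => by ring
  rw [this, h1, zero_div]

/-- Moving along a direction of strict decrease. -/
theorem HasFDerivAt.eventually_lt_of_neg {E : Type*} [NormedAddCommGroup E] [NormedSpace ℝ E]
    {g : E → ℝ} {g' : E →L[ℝ] ℝ} {x d : E} (hg : HasFDerivAt g g' x) (hd : g' d < 0) :
    ∀ᶠ t : ℝ in 𝓝[>] 0, g (x + t • d) < g x := by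
  have h1 : HasDerivAt (fun t : ℝ => g (x + t • d)) (g' d) 0 := by
    have h2 : HasDerivAt (fun t : ℝ => x + t • d) d 0 := by
      simpa using ((hasDerivAt_id (0 : ℝ)).smul_const d).const_add x
    have hg0 : HasFDerivAt g g' (x + (0 : ℝ) • d) := by simpa using hg
    exact hg0.comp_hasDerivAt (0 : ℝ) h2
  have h3 := (hasDerivAt_iff_tendsto_slope.1 h1).mono_left
    (nhdsWithin_mono (0 : ℝ) (fun t (ht : 0 < t) => ht.ne'))
  filter_upwards [h3.eventually (gt_mem_nhds hd), self_mem_nhdsWithin] with t ht ht0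
  have ht0 : (0 : ℝ) < t := ht0
  simp only [slope_def_field, sub_zero, zero_smul, add_zero] at ht
  rw [div_lt_iff₀ ht0, zero_mul] at ht
  linarith

/-- Karush-Kuhn-Tucker conditions at a local minimum under the Mangasarian-Fromovitz constraint
qualification; constraints that hold identically are exempt from it. -/
theorem exists_kkt_multipliers {E ι : Type*} [NormedAddCommGroup E] [NormedSpace ℝ E] [Fintype ι]
    {V : Submodule ℝ E} {f : E → ℝ} {c : ι → E → ℝ} {f' : E →L[ℝ] ℝ} {c' : ι → E →L[ℝ] ℝ} {x : E}
    (hx : x ∈ V) (hcx : ∀ j, c j x ≤ 0) (hf : HasFDerivAt f f' x)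
    (hc : ∀ j, HasFDerivAt (c j) (c' j) x)
    (hmin : ∀ᶠ y in 𝓝 x, y ∈ V → (∀ j, c j y ≤ 0) → f x ≤ f y) {d₀ : E} (hd₀ : d₀ ∈ V)
    (hcq : ∀ j, c j x = 0 → c' j d₀ < 0 ∨ ∀ y, c j y ≤ 0) :
    ∃ μ : ι → ℝ, (∀ j, 0 ≤ μ j) ∧ (∀ j, μ j * c j x = 0) ∧
      ∀ d ∈ V, f' d + ∑ j, μ j * c' j d = 0 := by
  classical
  -- Only these constraints receive multipliers. Inactive ones stay negative near x, and the other
  -- active ones can never be violated.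
  let A : Finset ι := Finset.univ.filter fun j => c j x = 0 ∧ c' j d₀ < 0
  have hmemA : ∀ j, j ∈ A ↔ c j x = 0 ∧ c' j d₀ < 0 := fun j => by simp [A]
  obtain ⟨μ, hμ, hμ'⟩ := exists_multipliers_of_slater V f'.toLinearMap
    (fun j : A => (c' j).toLinearMap) hd₀ (fun j => ((hmemA j).1 j.2).2) (by
      intro d hd hneg
      by_contra! hfd
      have hline : Tendsto (fun t : ℝ => x + t • d) (𝓝[>] 0) (𝓝 x) := by
        have : Continuous fun t : ℝ => x + t • d := by fun_prop
        simpa using (this.tendsto 0).mono_left nhdsWithin_le_nhds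
      have hcon : ∀ j, ∀ᶠ t : ℝ in 𝓝[>] 0, c j (x + t • d) ≤ 0 := by
        intro j
        by_cases hj : j ∈ A
        · filter_upwards [(hc j).eventually_lt_of_neg (hneg ⟨j, hj⟩)] with t ht
          exact (ht.trans_le (hcx j)).le
        · rcases (hcx j).lt_or_eq with h | h
          · filter_upwards [((hc j).continuousAt.tendsto.comp hline).eventually (gt_mem_nhds h)]
              with t ht
            exact le_of_lt ht
          · rcases hcq j h with h' | h'
            · exact absurd ((hmemA j).2 ⟨h, h'⟩) hj
            · exact Eventually.of_forall fun t => h' _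
      obtain ⟨t, h1, h2, h3⟩ := ((hline.eventually hmin).and
        ((eventually_all.2 hcon).and (hf.eventually_lt_of_neg hfd))).exists
      exact absurd (h1 (V.add_mem hx (V.smul_mem _ hd)) h2) (not_le.2 h3))
  refine ⟨fun j => if h : j ∈ A then μ ⟨j, h⟩ else 0, fun j => ?_, fun j => ?_, fun d hd => ?_⟩
  · dsimp only
    split_ifs
    exacts [hμ _, le_rfl]
  · dsimp only
    split_ifs with h
    · rw [((hmemA j).1 h).1, mul_zero]
    · rw [zero_mul]
  · refine Eq.trans ?_ (hμ' d hd)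
    simp only [ContinuousLinearMap.coe_coe]
    congr 1
    rw [← Finset.sum_subset (Finset.subset_univ A) (fun j _ hj => by simp [hj]),
      ← Finset.sum_coe_sort A]
    exact Finset.sum_congr rfl fun j _ => by simp

/-- If all cluster points of a sequence in a compact set lie in `S`, the distance of the sequence
to `S` tends to zero. -/
theorem IsCompact.tendsto_infDist_zero {X : Type*} [PseudoMetricSpace X] {K S : Set X}
    (hK : IsCompact K) {l : Filter ℕ} {y : ℕ → X} (hy : ∀ᶠ n in l, y n ∈ K)
    (hS : ∀ x, MapClusterPt x l y → x ∈ S) :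
    Tendsto (fun n => Metric.infDist (y n) S) l (𝓝 0) := by
  -- Along an ultrafilter the sequence converges in K, and its limit is a cluster point, hence in S.
  rw [tendsto_iff_ultrafilter]
  intro U hU
  have hyU : y ⁻¹' K ∈ U := hU hy
  obtain ⟨a, -, ha⟩ := hK.ultrafilter_le_nhds (U.map y) (by simpa using hyU)
  have ha' : Tendsto y U (𝓝 a) := ha
  have haS : a ∈ S := hS a (mapClusterPt_iff_ultrafilter.2 ⟨U, hU, ha'⟩)
  have := ((Metric.continuous_infDist_pt S).tendsto a).comp ha'
  rwa [Metric.infDist_zero_of_mem haS] at this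

/-! ### The Hermitian form and the scalar quadratic transform -/

section HermitianForm

variable {ℬ : Type*} [Fintype ℬ] {L : ℕ}

theorem herm_conj_symm (x y : ℬ → EuclideanSpace ℂ (Fin L)) :
    (starRingEnd ℂ) (herm x y) = herm y x := by
  simp [herm, map_sum, inner_conj_symm]

theorem norm_herm_comm (x y : ℬ → EuclideanSpace ℂ (Fin L)) : ‖herm x y‖ = ‖herm y x‖ := by
  rw [← herm_conj_symm x y, RCLike.norm_conj]

theorem differentiable_herm_right (x : ℬ → EuclideanSpace ℂ (Fin L)) :
    Differentiable ℝ fun y : ℬ → EuclideanSpace ℂ (Fin L) => herm x y := by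
  unfold herm
  refine Differentiable.fun_sum fun b _ => Differentiable.inner ℂ (differentiable_const _) ?_
  fun_prop

theorem differentiable_herm_left (y : ℬ → EuclideanSpace ℂ (Fin L)) :
    Differentiable ℝ fun x : ℬ → EuclideanSpace ℂ (Fin L) => herm x y := by
  unfold herm
  refine Differentiable.fun_sum fun b _ => Differentiable.inner ℂ ?_ (differentiable_const _)
  fun_prop

end HermitianForm

/-- Completing the square in the quadratic transform. -/
theorem two_mul_re_sub_le_div (u a : ℂ) {D : ℝ} (hD : 0 < D) :
    2 * ((starRingEnd ℂ) u * a).re - ‖u‖ ^ 2 * D ≤ ‖a‖ ^ 2 / D := by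
  rw [le_div_iff₀ hD, Complex.sq_norm, Complex.sq_norm, Complex.normSq_apply, Complex.normSq_apply]
  simp only [Complex.mul_re, Complex.conj_re, Complex.conj_im]
  nlinarith [sq_nonneg (u.re * D - a.re), sq_nonneg (u.im * D - a.im)]

/-- The square vanishes at u = a / D, so this choice attains the bound. -/
theorem two_mul_re_sub_eq_div (a : ℂ) {D : ℝ} (hD : 0 < D) :
    2 * ((starRingEnd ℂ) (a / (D : ℂ)) * a).re - ‖a / (D : ℂ)‖ ^ 2 * D = ‖a‖ ^ 2 / D := by
  have h1 : (starRingEnd ℂ) (a / (D : ℂ)) * a = ((‖a‖ ^ 2 / D : ℝ) : ℂ) := by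
    rw [map_div₀, Complex.conj_ofReal, div_mul_eq_mul_div, mul_comm, Complex.mul_conj,
      Complex.normSq_eq_norm_sq]
    push_cast
    ring
  rw [h1, Complex.ofReal_re, norm_div, Complex.norm_real, Real.norm_of_nonneg hD.le]
  field_simp
  ring

/-- The exponential form implies 0 < 1 + s by itself and is continuous in r and s, so it gives
closed feasible sets with no separate domain condition. -/
theorem le_mul_logb_iff {τ r s : ℝ} (hτ : 0 < τ) (hs : 0 < 1 + s) :
    r ≤ τ * Real.logb 2 (1 + s) ↔ (2 : ℝ) ^ (r / τ) ≤ 1 + s := by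
  rw [← Real.le_logb_iff_rpow_le one_lt_two hs, div_le_iff₀ hτ, mul_comm]

/-! ### Objective, power and fronthaul load -/

namespace Network

variable {ℬ 𝒦 : Type*} [Fintype ℬ] [Fintype 𝒦] {L : ℕ}

theorem differentiable_norm_herm_sq_fst (N : Network ℬ 𝒦 L) (k j : 𝒦) :
    Differentiable ℝ fun w : Precoders ℬ 𝒦 L => ‖herm (N.h k) (w.1 j)‖ ^ 2 :=
  Differentiable.norm_sq ℂ ((differentiable_herm_right (N.h k)).comp (by fun_prop))

theorem differentiable_norm_herm_sq_snd (N : Network ℬ 𝒦 L) (k j : 𝒦) :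
    Differentiable ℝ fun w : Precoders ℬ 𝒦 L => ‖herm (N.h k) (w.2 j)‖ ^ 2 :=
  Differentiable.norm_sq ℂ ((differentiable_herm_right (N.h k)).comp (by fun_prop))

theorem differentiable_Ψ (N : Network ℬ 𝒦 L) : Differentiable ℝ N.Ψ := by
  have h : N.Ψ = fun x : Precoders ℬ 𝒦 L × Rates 𝒦 =>
      N.α * (1 / (Fintype.card 𝒦 : ℝ)) * ∑ k, (x.2.1 k + x.2.2 k - N.rdes k) ^ 2
        + (1 - N.α) * ∑ k, (∑ b, ‖x.1.1 k b‖ ^ 2 + ∑ b, ‖x.1.2 k b‖ ^ 2) := by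
    funext x
    simp only [Ψ, sq_abs]
  rw [h]
  refine Differentiable.fun_add (by fun_prop) (Differentiable.const_mul
    (Differentiable.fun_sum fun k _ => Differentiable.fun_add ?_ ?_) _)
  · exact Differentiable.fun_sum fun b _ => Differentiable.norm_sq ℂ (by fun_prop)
  · exact Differentiable.fun_sum fun b _ => Differentiable.norm_sq ℂ (by fun_prop)

theorem Ψ_nonneg (N : Network ℬ 𝒦 L) (x : Precoders ℬ 𝒦 L × Rates 𝒦) : 0 ≤ N.Ψ x := by
  have h1 := N.α_nonneg
  have h2 : 0 ≤ 1 - N.α := sub_nonneg.2 N.α_le_one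
  unfold Ψ
  positivity

theorem differentiable_txPower (N : Network ℬ 𝒦 L) (b : ℬ) :
    Differentiable ℝ fun w : Precoders ℬ 𝒦 L => N.txPower w b := by
  unfold txPower
  refine Differentiable.fun_add ?_ ?_
  · exact Differentiable.fun_sum fun b _ => Differentiable.norm_sq ℂ (by fun_prop)
  · exact Differentiable.fun_sum fun b _ => Differentiable.norm_sq ℂ (by fun_prop)

theorem differentiable_fronthaulLoad (N : Network ℬ 𝒦 L) (b : ℬ) :
    Differentiable ℝ fun r : Rates 𝒦 => N.fronthaulLoad r b := by
  unfold fronthaulLoad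
  fun_prop

theorem fronthaulLoad_add_smul (N : Network ℬ 𝒦 L) (r d : Rates 𝒦) (t : ℝ) (b : ℬ) :
    N.fronthaulLoad (r + t • d) b = N.fronthaulLoad r b + t * N.fronthaulLoad d b := by
  simp only [fronthaulLoad, Prod.fst_add, Prod.snd_add, Prod.smul_fst, Prod.smul_snd, Pi.add_apply,
    Pi.smul_apply, smul_eq_mul, Finset.sum_add_distrib, mul_add, Finset.mul_sum]
  ring

theorem txPower_smul (N : Network ℬ 𝒦 L) (w : Precoders ℬ 𝒦 L) (t : ℝ) (b : ℬ) :
    N.txPower (t • w) b = t ^ 2 * N.txPower w b := by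
  simp only [txPower, Prod.smul_fst, Prod.smul_snd, Pi.smul_apply, norm_smul, mul_pow,
    Real.norm_eq_abs, sq_abs, mul_add, Finset.mul_sum]

/-- Clustering removes every block that the power constraint does not count, and each counted block
has norm at most √(P b). The sum over b is a crude bound for the maximum. -/
theorem norm_le_of_txPower_le (N : Network ℬ 𝒦 L) {w : Precoders ℬ 𝒦 L} (hw : w ∈ N.clustered)
    (hP : ∀ b, N.txPower w b ≤ N.P b) : ‖w‖ ≤ ∑ b, √(N.P b) := by
  have h0 : 0 ≤ ∑ b, √(N.P b) := Finset.sum_nonneg fun _ _ => Real.sqrt_nonneg _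
  have hs : ∀ b, √(N.P b) ≤ ∑ b, √(N.P b) := fun b =>
    Finset.single_le_sum (f := fun b => √(N.P b)) (fun _ _ => Real.sqrt_nonneg _)
      (Finset.mem_univ b)
  refine norm_prod_le_iff.2 ⟨?_, ?_⟩
  · refine (pi_norm_le_iff_of_nonneg h0).2 fun k => (pi_norm_le_iff_of_nonneg h0).2 fun b => ?_
    by_cases hk : k ∈ N.Kp b
    · refine (Real.le_sqrt_of_sq_le ?_).trans (hs b)
      have h1 : ‖w.1 k b‖ ^ 2 ≤ ∑ k ∈ N.Kp b, ‖w.1 k b‖ ^ 2 :=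
        Finset.single_le_sum (f := fun k => ‖w.1 k b‖ ^ 2) (fun _ _ => sq_nonneg _) hk
      have h2 : 0 ≤ ∑ k ∈ N.Kc b, ‖w.2 k b‖ ^ 2 := Finset.sum_nonneg fun _ _ => sq_nonneg _
      have h3 := hP b
      unfold txPower at h3
      linarith
    · rw [hw.1 k b hk, norm_zero]
      exact h0
  · refine (pi_norm_le_iff_of_nonneg h0).2 fun k => (pi_norm_le_iff_of_nonneg h0).2 fun b => ?_
    by_cases hk : k ∈ N.Kc b
    · refine (Real.le_sqrt_of_sq_le ?_).trans (hs b)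
      have h1 : ‖w.2 k b‖ ^ 2 ≤ ∑ k ∈ N.Kc b, ‖w.2 k b‖ ^ 2 :=
        Finset.single_le_sum (f := fun k => ‖w.2 k b‖ ^ 2) (fun _ _ => sq_nonneg _) hk
      have h2 : 0 ≤ ∑ k ∈ N.Kp b, ‖w.1 k b‖ ^ 2 := Finset.sum_nonneg fun _ _ => sq_nonneg _
      have h3 := hP b
      unfold txPower at h3
      linarith
    · rw [hw.2 k b hk, norm_zero]
      exact h0

theorem differentiableAt_rateBound (N : Network ℬ 𝒦 L) {g : Precoders ℬ 𝒦 L → ℝ}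
    (hg : Differentiable ℝ g) {w : Precoders ℬ 𝒦 L} (h : 0 < 1 + g w) :
    DifferentiableAt ℝ (fun w => N.τ * Real.logb 2 (1 + g w)) w := by
  simp only [Real.logb, div_eq_mul_inv]
  exact ((((hg w).const_add 1).log h.ne').mul_const _).const_mul _

/-! ### SINRs and their quadratic minorants -/

variable [DecidableEq 𝒦]

theorem differentiable_intfP (N : Network ℬ 𝒦 L) (k : 𝒦) :
    Differentiable ℝ fun w : Precoders ℬ 𝒦 L => N.intfP w k := by
  unfold intfP
  exact ((Differentiable.fun_sum fun j _ => N.differentiable_norm_herm_sq_fst k j).add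
    (Differentiable.fun_sum fun j _ => N.differentiable_norm_herm_sq_snd k j)).add_const _

theorem differentiable_intfC (N : Network ℬ 𝒦 L) (i k : 𝒦) :
    Differentiable ℝ fun w : Precoders ℬ 𝒦 L => N.intfC w i k := by
  unfold intfC
  exact ((Differentiable.fun_sum fun j _ => N.differentiable_norm_herm_sq_fst k j).add
    (Differentiable.fun_sum fun j _ => N.differentiable_norm_herm_sq_snd k j)).add_const _

theorem sq_le_intfP (N : Network ℬ 𝒦 L) (w : Precoders ℬ 𝒦 L) (k : 𝒦) :
    N.σ ^ 2 ≤ N.intfP w k := by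
  have h1 : 0 ≤ ∑ j ∈ Finset.univ \ {k}, ‖herm (N.h k) (w.1 j)‖ ^ 2 :=
    Finset.sum_nonneg fun _ _ => sq_nonneg _
  have h2 : 0 ≤ ∑ l ∈ Finset.univ \ N.I k, ‖herm (N.h k) (w.2 l)‖ ^ 2 :=
    Finset.sum_nonneg fun _ _ => sq_nonneg _
  unfold intfP
  linarith

theorem sq_le_intfC (N : Network ℬ 𝒦 L) (w : Precoders ℬ 𝒦 L) (i k : 𝒦) :
    N.σ ^ 2 ≤ N.intfC w i k := by
  have h1 : 0 ≤ ∑ j, ‖herm (N.h k) (w.1 j)‖ ^ 2 := Finset.sum_nonneg fun _ _ => sq_nonneg _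
  have h2 : 0 ≤ ∑ l ∈ (Finset.univ \ N.I k) ∪ N.I' i k, ‖herm (N.h k) (w.2 l)‖ ^ 2 :=
    Finset.sum_nonneg fun _ _ => sq_nonneg _
  unfold intfC
  linarith

theorem intfP_pos (N : Network ℬ 𝒦 L) (w : Precoders ℬ 𝒦 L) (k : 𝒦) : 0 < N.intfP w k :=
  (pow_pos N.σ_pos 2).trans_le (N.sq_le_intfP w k)

theorem intfC_pos (N : Network ℬ 𝒦 L) (w : Precoders ℬ 𝒦 L) (i k : 𝒦) : 0 < N.intfC w i k :=
  (pow_pos N.σ_pos 2).trans_le (N.sq_le_intfC w i k)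

/-- All SINRs `(Γ^p, Γ^c)`. -/
noncomputable def sinr (N : Network ℬ 𝒦 L) (w : Precoders ℬ 𝒦 L) : SinrVars 𝒦 :=
  (fun k => N.sinrP w k, fun i k => N.sinrC w i k)

/-- The largest SINR variables that the quadratic transform allows for auxiliary variables `u`. -/
noncomputable def qtBound (N : Network ℬ 𝒦 L) (u : AuxVars 𝒦) (w : Precoders ℬ 𝒦 L) :
    SinrVars 𝒦 :=
  (fun k => 2 * (starRingEnd ℂ (u.1 k) * herm (w.1 k) (N.h k)).re - ‖u.1 k‖ ^ 2 * N.intfP w k,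
   fun i k =>
    2 * (starRingEnd ℂ (u.2 i k) * herm (w.2 i) (N.h k)).re - ‖u.2 i k‖ ^ 2 * N.intfC w i k)

theorem sinr_nonneg (N : Network ℬ 𝒦 L) (w : Precoders ℬ 𝒦 L) : 0 ≤ N.sinr w :=
  ⟨fun k => div_nonneg (sq_nonneg _) (N.intfP_pos w k).le,
   fun i k => div_nonneg (sq_nonneg _) (N.intfC_pos w i k).le⟩

theorem qtBound_le_sinr (N : Network ℬ 𝒦 L) (u : AuxVars 𝒦) (w : Precoders ℬ 𝒦 L) :
    N.qtBound u w ≤ N.sinr w := by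
  refine ⟨fun k => ?_, fun i k => ?_⟩
  · simp only [qtBound, sinr, sinrP]
    rw [norm_herm_comm]
    exact two_mul_re_sub_le_div _ _ (N.intfP_pos w k)
  · simp only [qtBound, sinr, sinrC]
    rw [norm_herm_comm]
    exact two_mul_re_sub_le_div _ _ (N.intfC_pos w i k)

theorem qtBound_auxUpdate (N : Network ℬ 𝒦 L) (w : Precoders ℬ 𝒦 L) :
    N.qtBound (N.auxUpdate w) w = N.sinr w := by
  refine Prod.ext (funext fun k => ?_) (funext fun i => funext fun k => ?_)
  · simp only [qtBound, sinr, sinrP, auxUpdate]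
    rw [norm_herm_comm (N.h k)]
    exact two_mul_re_sub_eq_div _ (N.intfP_pos w k)
  · simp only [qtBound, sinr, sinrC, auxUpdate]
    rw [norm_herm_comm (N.h k)]
    exact two_mul_re_sub_eq_div _ (N.intfC_pos w i k)

theorem differentiable_sinr_fst (N : Network ℬ 𝒦 L) (k : 𝒦) :
    Differentiable ℝ fun w : Precoders ℬ 𝒦 L => (N.sinr w).1 k := by
  simp only [sinr, sinrP, div_eq_mul_inv]
  exact (N.differentiable_norm_herm_sq_fst k k).fun_mul <| (N.differentiable_intfP k).fun_inv
    fun w => (N.intfP_pos w k).ne'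

theorem differentiable_sinr_snd (N : Network ℬ 𝒦 L) (i k : 𝒦) :
    Differentiable ℝ fun w : Precoders ℬ 𝒦 L => (N.sinr w).2 i k := by
  simp only [sinr, sinrC, div_eq_mul_inv]
  exact (N.differentiable_norm_herm_sq_snd k i).fun_mul <| (N.differentiable_intfC i k).fun_inv
    fun w => (N.intfC_pos w i k).ne'

theorem differentiable_qtBound_fst (N : Network ℬ 𝒦 L) (u : AuxVars 𝒦) (k : 𝒦) :
    Differentiable ℝ fun w : Precoders ℬ 𝒦 L => (N.qtBound u w).1 k := by
  simp only [qtBound]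
  refine Differentiable.fun_sub (Differentiable.const_mul ?_ _)
    ((N.differentiable_intfP k).const_mul _)
  exact Complex.reCLM.differentiable.comp
    (((differentiable_herm_left (N.h k)).comp (by fun_prop)).const_mul _)

theorem differentiable_qtBound_snd (N : Network ℬ 𝒦 L) (u : AuxVars 𝒦) (i k : 𝒦) :
    Differentiable ℝ fun w : Precoders ℬ 𝒦 L => (N.qtBound u w).2 i k := by
  simp only [qtBound]
  refine Differentiable.fun_sub (Differentiable.const_mul ?_ _)
    ((N.differentiable_intfC i k).const_mul _)
  exact Complex.reCLM.differentiable.comp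
    (((differentiable_herm_left (N.h k)).comp (by fun_prop)).const_mul _)

theorem continuous_sinr (N : Network ℬ 𝒦 L) : Continuous N.sinr :=
  (continuous_pi fun k => (N.differentiable_sinr_fst k).continuous).prodMk
    (continuous_pi fun i => continuous_pi fun k => (N.differentiable_sinr_snd i k).continuous)

theorem continuous_qtBound (N : Network ℬ 𝒦 L) (u : AuxVars 𝒦) : Continuous (N.qtBound u) :=
  (continuous_pi fun k => (N.differentiable_qtBound_fst u k).continuous).prodMk
    (continuous_pi fun i => continuous_pi fun k => (N.differentiable_qtBound_snd u i k).continuous)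

theorem continuous_qtBound_left (N : Network ℬ 𝒦 L) (w : Precoders ℬ 𝒦 L) :
    Continuous fun u => N.qtBound u w := by
  unfold qtBound
  refine (continuous_pi fun k => ?_).prodMk (continuous_pi fun i => continuous_pi fun k => ?_)
  · exact (continuous_const.mul (Complex.continuous_re.comp
      ((Complex.continuous_conj.comp (by fun_prop)).mul continuous_const))).sub (by fun_prop)
  · exact (continuous_const.mul (Complex.continuous_re.comp
      ((Complex.continuous_conj.comp (by fun_prop)).mul continuous_const))).sub (by fun_prop)

theorem continuous_auxUpdate (N : Network ℬ 𝒦 L) : Continuous N.auxUpdate := by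
  unfold auxUpdate
  refine (continuous_pi fun k => ?_).prodMk (continuous_pi fun i => continuous_pi fun k => ?_)
  · refine Continuous.div₀ ((differentiable_herm_left (N.h k)).continuous.comp (by fun_prop))
      (Complex.continuous_ofReal.comp (N.differentiable_intfP k).continuous) fun w => ?_
    exact Complex.ofReal_ne_zero.2 (N.intfP_pos w k).ne'
  · refine Continuous.div₀ ((differentiable_herm_left (N.h k)).continuous.comp (by fun_prop))
      (Complex.continuous_ofReal.comp (N.differentiable_intfC i k).continuous) fun w => ?_
    exact Complex.ofReal_ne_zero.2 (N.intfC_pos w i k).ne'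

/-! ### Feasible sets after elimination of γ -/

/-- Feasibility of `(w, r)` when the rates are limited by the SINR values `s`; the rate constraints
are written in exponential form. -/
structure Admissible (N : Network ℬ 𝒦 L) (s : SinrVars 𝒦) (x : Precoders ℬ 𝒦 L × Rates 𝒦) :
    Prop where
  clustering : x.1 ∈ N.clustered
  fronthaul : ∀ b, N.fronthaulLoad x.2 b ≤ N.C b
  power : ∀ b, N.txPower x.1 b ≤ N.P b
  rateP : ∀ k, (2 : ℝ) ^ (x.2.1 k / N.τ) ≤ 1 + s.1 k
  rateC : ∀ k, ∀ i ∈ N.I k, (2 : ℝ) ^ (x.2.2 i / N.τ) ≤ 1 + s.2 i k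

theorem Admissible.mono {N : Network ℬ 𝒦 L} {s t : SinrVars 𝒦} {x : Precoders ℬ 𝒦 L × Rates 𝒦}
    (h : N.Admissible s x) (hst : s ≤ t) : N.Admissible t x where
  clustering := h.clustering
  fronthaul := h.fronthaul
  power := h.power
  rateP k := (h.rateP k).trans (by have := hst.1 k; linarith)
  rateC k i hi := (h.rateC k i hi).trans (by have := hst.2 i k; linarith)

/-- The constraints `qtP` and `qtC` say that γ is at most `qtBound u w`. Since the rate bounds
increase with γ, nothing is lost by taking γ equal to that bound, so the problem depends on (w, r)
alone. -/
theorem Opt3Feasible.admissible {N : Network ℬ 𝒦 L} {u : AuxVars 𝒦} {w : Precoders ℬ 𝒦 L}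
    {r : Rates 𝒦} {γ : SinrVars 𝒦} (h : N.Opt3Feasible u w r γ) :
    N.Admissible (N.qtBound u w) (w, r) where
  clustering := h.clustering
  fronthaul := h.fronthaul
  power := h.power
  rateP k := by
    have h1 := h.qtP k
    have h2 := (le_mul_logb_iff N.τ_pos (h.gammaP_dom k)).1 (h.rateP k)
    unfold gP at h1
    refine h2.trans ?_
    simp only [qtBound]
    linarith
  rateC k i hi := by
    have h1 := h.qtC k i hi
    have h2 := (le_mul_logb_iff N.τ_pos (h.gammaC_dom k i hi)).1 (h.rateC k i hi)
    unfold gC at h1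
    refine h2.trans ?_
    simp only [qtBound]
    linarith

theorem Admissible.opt3Feasible {N : Network ℬ 𝒦 L} {u : AuxVars 𝒦} {w : Precoders ℬ 𝒦 L}
    {r : Rates 𝒦} (h : N.Admissible (N.qtBound u w) (w, r)) :
    N.Opt3Feasible u w r
      ((N.qtBound u w).1, fun i k => if i ∈ N.I k then (N.qtBound u w).2 i k else 0) where
  clustering := h.clustering
  fronthaul := h.fronthaul
  power := h.power
  gammaP_dom k := (Real.rpow_pos_of_pos two_pos _).trans_le (h.rateP k)
  gammaC_dom k i hi := by
    simp only [hi, if_true]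
    exact (Real.rpow_pos_of_pos two_pos _).trans_le (h.rateC k i hi)
  gammaC_off k i hi := by simp [hi]
  rateP k := (le_mul_logb_iff N.τ_pos
    ((Real.rpow_pos_of_pos two_pos _).trans_le (h.rateP k))).2 (h.rateP k)
  rateC k i hi := by
    simp only [hi, if_true]
    exact (le_mul_logb_iff N.τ_pos
      ((Real.rpow_pos_of_pos two_pos _).trans_le (h.rateC k i hi))).2 (h.rateC k i hi)
  qtP k := by simp [gP, qtBound]
  qtC k i hi := by simp [gC, qtBound, hi]

theorem SolvesOpt3.le_of_admissible {N : Network ℬ 𝒦 L} {u : AuxVars 𝒦} {w : Precoders ℬ 𝒦 L}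
    {r : Rates 𝒦} {γ : SinrVars 𝒦} (h : N.SolvesOpt3 u w r γ) {x : Precoders ℬ 𝒦 L × Rates 𝒦}
    (hx : N.Admissible (N.qtBound u x.1) x) : N.Ψ (w, r) ≤ N.Ψ x :=
  h.2 _ _ _ (Admissible.opt3Feasible hx)

theorem isClosed_admissible (N : Network ℬ 𝒦 L) {s : Precoders ℬ 𝒦 L → SinrVars 𝒦}
    (hs : Continuous s) : IsClosed {x | N.Admissible (s x.1) x} := by
  have hs1 : ∀ k, Continuous fun x : Precoders ℬ 𝒦 L × Rates 𝒦 => 1 + (s x.1).1 k :=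
    fun k => continuous_const.add ((continuous_apply k).comp
      (continuous_fst.comp (hs.comp continuous_fst)))
  have hs2 : ∀ i k, Continuous fun x : Precoders ℬ 𝒦 L × Rates 𝒦 => 1 + (s x.1).2 i k :=
    fun i k => continuous_const.add ((continuous_apply k).comp ((continuous_apply i).comp
      (continuous_snd.comp (hs.comp continuous_fst))))
  have hpow : ∀ g : Precoders ℬ 𝒦 L × Rates 𝒦 → ℝ, Continuous g →
      Continuous fun x => (2 : ℝ) ^ (g x / N.τ) := fun g hg =>
    (Real.continuous_const_rpow two_ne_zero).comp (hg.div_const _)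
  have hset : {x | N.Admissible (s x.1) x} =
      {x | (∀ k b, k ∉ N.Kp b → x.1.1 k b = 0)} ∩ {x | (∀ k b, k ∉ N.Kc b → x.1.2 k b = 0)} ∩
      {x | ∀ b, N.fronthaulLoad x.2 b ≤ N.C b} ∩ {x | ∀ b, N.txPower x.1 b ≤ N.P b} ∩
      {x | ∀ k, (2 : ℝ) ^ (x.2.1 k / N.τ) ≤ 1 + (s x.1).1 k} ∩
      {x | ∀ k, ∀ i ∈ N.I k, (2 : ℝ) ^ (x.2.2 i / N.τ) ≤ 1 + (s x.1).2 i k} := by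
    ext x
    exact ⟨fun h => ⟨⟨⟨⟨⟨h.clustering.1, h.clustering.2⟩, h.fronthaul⟩, h.power⟩, h.rateP⟩, h.rateC⟩,
      fun ⟨⟨⟨⟨⟨h1, h2⟩, h3⟩, h4⟩, h5⟩, h6⟩ => ⟨⟨h1, h2⟩, h3, h4, h5, h6⟩⟩
  rw [hset]
  simp only [Set.ofPred_forall]
  refine ((((IsClosed.inter ?_ ?_).inter ?_).inter ?_).inter ?_).inter ?_
  · exact isClosed_iInter fun k => isClosed_iInter fun b => isClosed_iInter fun _ =>
      isClosed_eq (by fun_prop) continuous_const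
  · exact isClosed_iInter fun k => isClosed_iInter fun b => isClosed_iInter fun _ =>
      isClosed_eq (by fun_prop) continuous_const
  · exact isClosed_iInter fun b => isClosed_le
      ((N.differentiable_fronthaulLoad b).continuous.comp continuous_snd) continuous_const
  · exact isClosed_iInter fun b => isClosed_le
      ((N.differentiable_txPower b).continuous.comp continuous_fst) continuous_const
  · exact isClosed_iInter fun k => isClosed_le (hpow _ (by fun_prop)) (hs1 k)
  · exact isClosed_iInter fun k => isClosed_iInter fun i => isClosed_iInter fun _ =>
      isClosed_le (hpow _ (by fun_prop)) (hs2 i k)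

theorem admissible_zero (N : Network ℬ 𝒦 L) {w : Precoders ℬ 𝒦 L} (hw : N.FeasiblePrecoders w) :
    N.Admissible (N.sinr w) (w, 0) where
  clustering := hw.1
  fronthaul b := by simpa [fronthaulLoad] using N.C_nonneg b
  power := hw.2
  rateP k := by simpa using (N.sinr_nonneg w).1 k
  rateC k i _ := by simpa using (N.sinr_nonneg w).2 i k

/-! ### Constraint qualification and transfer of stationarity -/

/-- The constraints in the variables `(w, r)` when the rates are limited by SINR values `s w`. -/
noncomputable def sinrConstraint (N : Network ℬ 𝒦 L) (s : Precoders ℬ 𝒦 L → SinrVars 𝒦) :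
    N.Opt1Index → Precoders ℬ 𝒦 L × Rates 𝒦 → ℝ
  | .inl b, x => N.fronthaulLoad x.2 b - N.C b
  | .inr (.inl b), x => N.txPower x.1 b - N.P b
  | .inr (.inr (.inl k)), x => x.2.1 k - N.τ * Real.logb 2 (1 + (s x.1).1 k)
  | .inr (.inr (.inr q)), x => x.2.2 q.1.1 - N.τ * Real.logb 2 (1 + (s x.1).2 q.1.1 q.1.2)

theorem opt1Constraint_eq (N : Network ℬ 𝒦 L) : N.opt1Constraint = N.sinrConstraint N.sinr := by
  funext j x
  rcases j with b | b | k | q <;> rfl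

theorem admissible_iff_sinrConstraint_nonpos (N : Network ℬ 𝒦 L)
    {s : Precoders ℬ 𝒦 L → SinrVars 𝒦} {x : Precoders ℬ 𝒦 L × Rates 𝒦}
    (h1 : ∀ k, 0 < 1 + (s x.1).1 k) (h2 : ∀ i k, 0 < 1 + (s x.1).2 i k) :
    N.Admissible (s x.1) x ↔ x.1 ∈ N.clustered ∧ ∀ j, N.sinrConstraint s j x ≤ 0 := by
  constructor
  · intro h
    refine ⟨h.clustering, ?_⟩
    rintro (b | b | k | q)
    · exact sub_nonpos.2 (h.fronthaul b)
    · exact sub_nonpos.2 (h.power b)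
    · exact sub_nonpos.2 ((le_mul_logb_iff N.τ_pos (h1 k)).2 (h.rateP k))
    · exact sub_nonpos.2 ((le_mul_logb_iff N.τ_pos (h2 _ _)).2 (h.rateC _ _ q.2))
  · rintro ⟨hc, h⟩
    exact ⟨hc, fun b => sub_nonpos.1 (h (.inl b)), fun b => sub_nonpos.1 (h (.inr (.inl b))),
      fun k => (le_mul_logb_iff N.τ_pos (h1 k)).1 (sub_nonpos.1 (h (.inr (.inr (.inl k))))),
      fun k i hi => (le_mul_logb_iff N.τ_pos (h2 i k)).1
        (sub_nonpos.1 (h (.inr (.inr (.inr ⟨(i, k), hi⟩)))))⟩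

theorem differentiableAt_sinrConstraint (N : Network ℬ 𝒦 L) {s : Precoders ℬ 𝒦 L → SinrVars 𝒦}
    (hs1 : ∀ k, Differentiable ℝ fun w => (s w).1 k)
    (hs2 : ∀ i k, Differentiable ℝ fun w => (s w).2 i k) {x : Precoders ℬ 𝒦 L × Rates 𝒦}
    (h1 : ∀ k, 0 < 1 + (s x.1).1 k) (h2 : ∀ i k, 0 < 1 + (s x.1).2 i k) (j : N.Opt1Index) :
    DifferentiableAt ℝ (N.sinrConstraint s j) x := by
  rcases j with b | b | k | q
  · exact (((N.differentiable_fronthaulLoad b).comp differentiable_snd) x).sub_const _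
  · exact (((N.differentiable_txPower b).comp differentiable_fst) x).sub_const _
  · have h := DifferentiableAt.comp x (N.differentiableAt_rateBound (hs1 k) (h1 k))
      differentiableAt_fst
    exact DifferentiableAt.fun_sub (by fun_prop) h
  · have h := DifferentiableAt.comp x (N.differentiableAt_rateBound (hs2 q.1.1 q.1.2) (h2 _ _))
      differentiableAt_fst
    exact DifferentiableAt.fun_sub (by fun_prop) h

/-- Shrinking the precoders and lowering all rates sufficiently fast strictly decreases every
active constraint, except for fronthaul constraints that hold identically. -/
theorem exists_slater_direction (N : Network ℬ 𝒦 L) {s : Precoders ℬ 𝒦 L → SinrVars 𝒦}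
    (hs1 : ∀ k, Differentiable ℝ fun w => (s w).1 k)
    (hs2 : ∀ i k, Differentiable ℝ fun w => (s w).2 i k) {x : Precoders ℬ 𝒦 L × Rates 𝒦}
    (hx : x.1 ∈ N.clustered)
    (h1 : ∀ k, 0 < 1 + (s x.1).1 k) (h2 : ∀ i k, 0 < 1 + (s x.1).2 i k) :
    ∃ d ∈ N.clustered.prod (⊤ : Submodule ℝ (Rates 𝒦)), ∀ j, N.sinrConstraint s j x = 0 →
      fderiv ℝ (N.sinrConstraint s j) x d < 0 ∨ ∀ y, N.sinrConstraint s j y ≤ 0 := by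
  let φ : 𝒦 ⊕ 𝒦 × 𝒦 → Precoders ℬ 𝒦 L → ℝ := fun o w =>
    N.τ * Real.logb 2 (1 + o.elim (s w).1 fun q => (s w).2 q.1 q.2)
  -- The rates fall faster than any rate bound can fall to first order when the precoders move along
  -- -w; the 1 makes this strict.
  let t : ℝ := 1 + ∑ o, |fderiv ℝ (φ o) x.1 (-x.1)|
  have ht : ∀ o, -t - fderiv ℝ (φ o) x.1 (-x.1) < 0 := by
    intro o
    have := Finset.single_le_sum (f := fun o => |fderiv ℝ (φ o) x.1 (-x.1)|)
      (fun _ _ => abs_nonneg _) (Finset.mem_univ o)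
    have := neg_abs_le (fderiv ℝ (φ o) x.1 (-x.1))
    simp only [t]
    linarith
  have ht0 : 0 < t := by
    have : 0 ≤ ∑ o, |fderiv ℝ (φ o) x.1 (-x.1)| := Finset.sum_nonneg fun _ _ => abs_nonneg _
    simp only [t]
    linarith
  let d : Precoders ℬ 𝒦 L × Rates 𝒦 := (-x.1, (fun _ => -t, fun _ => -t))
  refine ⟨d, ⟨N.clustered.neg_mem hx, trivial⟩, ?_⟩
  have hline : ∀ j, HasDerivAt (fun ε : ℝ => N.sinrConstraint s j (x + ε • d))
      (fderiv ℝ (N.sinrConstraint s j) x d) 0 := fun j =>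
    (N.differentiableAt_sinrConstraint hs1 hs2 h1 h2 j).hasFDerivAt.hasLineDerivAt d
  rintro (b | b | k | q) hact
  -- A station serving nobody has zero load, so with C b = 0 its constraint is active everywhere and
  -- no direction decreases it. This is the exempt case.
  · by_cases hb : (N.Kp b).card + (N.Kc b).card = 0
    · obtain ⟨hb1, hb2⟩ := Nat.add_eq_zero_iff.1 hb
      right
      intro y
      simpa [sinrConstraint, fronthaulLoad, Finset.card_eq_zero.1 hb1, Finset.card_eq_zero.1 hb2]
        using N.C_nonneg b
    · left
      have hd : HasDerivAt (fun ε : ℝ => N.sinrConstraint s (.inl b) (x + ε • d))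
          (N.fronthaulLoad d.2 b) 0 := by
        simp only [sinrConstraint, Prod.snd_add, Prod.smul_snd, fronthaulLoad_add_smul]
        simpa using ((((hasDerivAt_id (0 : ℝ)).mul_const (N.fronthaulLoad d.2 b)).const_add
          (N.fronthaulLoad x.2 b)).sub_const (N.C b))
      rw [(hline _).unique hd]
      have hpos : (0 : ℝ) < (N.Kp b).card + (N.Kc b).card := by exact_mod_cast Nat.pos_of_ne_zero hb
      simp only [fronthaulLoad, d, Finset.sum_const, nsmul_eq_mul]
      nlinarith
  · left
    have hd : HasDerivAt (fun ε : ℝ => N.sinrConstraint s (.inr (.inl b)) (x + ε • d))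
        (-2 * N.txPower x.1 b) 0 := by
      have h : ∀ ε : ℝ, (x + ε • d).1 = (1 - ε) • x.1 := fun ε => by
        rw [sub_smul, one_smul, sub_eq_add_neg]
        simp [d]
      simp only [sinrConstraint, h, txPower_smul]
      have h' := (((((hasDerivAt_id (0 : ℝ)).const_sub 1).pow 2).mul_const
        (N.txPower x.1 b)).sub_const (N.P b))
      simpa using h'
    rw [(hline _).unique hd]
    -- An active power constraint has positive power, so scaling down strictly reduces it.
    have hact' : N.txPower x.1 b = N.P b := sub_eq_zero.1 hact
    have := N.P_pos b
    linarith
  · left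
    have hφ : HasFDerivAt (φ (.inl k)) (fderiv ℝ (φ (.inl k)) x.1) x.1 :=
      (N.differentiableAt_rateBound (hs1 k) (h1 k)).hasFDerivAt
    have hd : HasDerivAt (fun ε : ℝ => N.sinrConstraint s (.inr (.inr (.inl k))) (x + ε • d))
        (-t - fderiv ℝ (φ (.inl k)) x.1 (-x.1)) 0 := by
      have h := ((((hasDerivAt_id (0 : ℝ)).mul_const (-t)).const_add (x.2.1 k))).sub
        (hφ.hasLineDerivAt (-x.1))
      rw [one_mul] at h
      exact h
    rw [(hline _).unique hd]
    exact ht _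
  · left
    have hφ : HasFDerivAt (φ (.inr q.1)) (fderiv ℝ (φ (.inr q.1)) x.1) x.1 :=
      (N.differentiableAt_rateBound (hs2 q.1.1 q.1.2) (h2 _ _)).hasFDerivAt
    have hd : HasDerivAt (fun ε : ℝ => N.sinrConstraint s (.inr (.inr (.inr q))) (x + ε • d))
        (-t - fderiv ℝ (φ (.inr q.1)) x.1 (-x.1)) 0 := by
      have h := ((((hasDerivAt_id (0 : ℝ)).mul_const (-t)).const_add (x.2.2 q.1.1))).sub
        (hφ.hasLineDerivAt (-x.1))
      rw [one_mul] at h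
      exact h
    rw [(hline _).unique hd]
    exact ht _

theorem sinrConstraint_anti (N : Network ℬ 𝒦 L) {s t : Precoders ℬ 𝒦 L → SinrVars 𝒦}
    {x : Precoders ℬ 𝒦 L × Rates 𝒦} (hst : s x.1 ≤ t x.1)
    (h1 : ∀ k, 0 < 1 + (s x.1).1 k) (h2 : ∀ i k, 0 < 1 + (s x.1).2 i k) (j : N.Opt1Index) :
    N.sinrConstraint t j x ≤ N.sinrConstraint s j x := by
  rcases j with b | b | k | q
  · exact le_rfl
  · exact le_rfl
  · exact sub_le_sub_left (mul_le_mul_of_nonneg_left (Real.logb_le_logb_of_le one_lt_two (h1 k)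
      (add_le_add_right (hst.1 k) 1)) N.τ_pos.le) _
  · exact sub_le_sub_left (mul_le_mul_of_nonneg_left (Real.logb_le_logb_of_le one_lt_two (h2 _ _)
      (add_le_add_right (hst.2 _ _) 1)) N.τ_pos.le) _

/-- A minimizer of the surrogate problem with auxiliary variables computed from its own precoders
is a stationary solution of the original problem. -/
theorem isStationaryOpt1_of_isMinOn (N : Network ℬ 𝒦 L) {x : Precoders ℬ 𝒦 L × Rates 𝒦}
    (hx : N.Admissible (N.sinr x.1) x)
    (hmin : ∀ y, N.Admissible (N.qtBound (N.auxUpdate x.1) y.1) y → N.Ψ x ≤ N.Ψ y) :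
    N.IsStationaryOpt1 x := by
  set s := N.qtBound (N.auxUpdate x.1)
  have hsx : s x.1 = N.sinr x.1 := N.qtBound_auxUpdate x.1
  have p1 : ∀ k, 0 < 1 + (N.sinr x.1).1 k := fun k => by
    have := (N.sinr_nonneg x.1).1 k
    exact add_pos_of_pos_of_nonneg one_pos this
  have p2 : ∀ i k, 0 < 1 + (N.sinr x.1).2 i k := fun i k => by
    have := (N.sinr_nonneg x.1).2 i k
    exact add_pos_of_pos_of_nonneg one_pos this
  have q1 : ∀ k, 0 < 1 + (s x.1).1 k := hsx ▸ p1
  have q2 : ∀ i k, 0 < 1 + (s x.1).2 i k := hsx ▸ p2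
  have hd1 := N.differentiableAt_sinrConstraint N.differentiable_sinr_fst N.differentiable_sinr_snd
    p1 p2
  have hd2 := N.differentiableAt_sinrConstraint
    (N.differentiable_qtBound_fst (N.auxUpdate x.1))
    (N.differentiable_qtBound_snd (N.auxUpdate x.1)) q1 q2
  -- Away from x the minorant may drop to -1 or below, where the logarithm no longer expresses the
  -- rate constraint. Near x it does not, and a local minimum is all that KKT needs.
  have hpos : ∀ᶠ y in 𝓝 x, (∀ k, 0 < 1 + (s y.1).1 k) ∧ ∀ i k, 0 < 1 + (s y.1).2 i k := by
    have c1 : ∀ k, Continuous fun y : Precoders ℬ 𝒦 L × Rates 𝒦 => 1 + (s y.1).1 k := fun k =>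
      continuous_const.add ((N.differentiable_qtBound_fst _ k).continuous.comp continuous_fst)
    have c2 : ∀ i k, Continuous fun y : Precoders ℬ 𝒦 L × Rates 𝒦 => 1 + (s y.1).2 i k :=
      fun i k => continuous_const.add
        ((N.differentiable_qtBound_snd _ i k).continuous.comp continuous_fst)
    exact (eventually_all.2 fun k => (c1 k).continuousAt.eventually (lt_mem_nhds (q1 k))).and
      (eventually_all.2 fun i => eventually_all.2 fun k =>
        (c2 i k).continuousAt.eventually (lt_mem_nhds (q2 i k)))
  have hval : ∀ j, N.sinrConstraint s j x = N.sinrConstraint N.sinr j x := by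
    rintro (b | b | k | q) <;> simp only [sinrConstraint, hsx]
  have hgrad : ∀ j, fderiv ℝ (N.sinrConstraint s j) x = fderiv ℝ (N.sinrConstraint N.sinr j) x := by
    intro j
    -- Replacing the SINR by its minorant only tightens the constraints, with equality at x. The
    -- difference is thus minimal at x and has zero derivative there.
    have hloc : IsLocalMin (fun y => N.sinrConstraint s j y - N.sinrConstraint N.sinr j y) x := by
      filter_upwards [hpos] with y hy
      rw [hval j, sub_self]
      exact sub_nonneg.2 (N.sinrConstraint_anti (N.qtBound_le_sinr _ _) hy.1 hy.2 j)
    have h0 := hloc.fderiv_eq_zero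
    rw [fderiv_fun_sub (hd2 j) (hd1 j)] at h0
    exact sub_eq_zero.1 h0
  have hfeas := ((N.admissible_iff_sinrConstraint_nonpos p1 p2).1 hx).2
  obtain ⟨d, hdV, hd⟩ := N.exists_slater_direction
    (N.differentiable_qtBound_fst (N.auxUpdate x.1))
    (N.differentiable_qtBound_snd (N.auxUpdate x.1)) hx.clustering q1 q2
  have hxV : x ∈ N.clustered.prod (⊤ : Submodule ℝ (Rates 𝒦)) := ⟨hx.clustering, trivial⟩
  obtain ⟨μ, hμ1, hμ2, hμ3⟩ := exists_kkt_multipliers hxV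
    (fun j => (hval j).trans_le (hfeas j)) (N.differentiable_Ψ x).hasFDerivAt
    (fun j => (hd2 j).hasFDerivAt) (by
      filter_upwards [hpos] with y hy hyV hyc
      exact hmin y ((N.admissible_iff_sinrConstraint_nonpos hy.1 hy.2).2 ⟨hyV.1, hyc⟩)) hdV hd
  unfold IsStationaryOpt1
  rw [opt1Constraint_eq]
  refine ⟨hxV, hfeas, N.differentiable_Ψ x, hd1, μ, hμ1, fun j => ?_, fun v hv => ?_⟩
  · rw [← hval j]
    exact hμ2 j
  · simp only [← hgrad]
    exact hμ3 v hv

/-! ### Compactness and solvability of (Opt3) -/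

/-- For positive weight of the rate gap, and if all common messages are decoded, sublevel sets
of the objective are bounded on the feasible set. -/
theorem exists_norm_le_of_admissible (N : Network ℬ 𝒦 L) (hα : 0 < N.α)
    (hM : ∀ i, (N.M i).Nonempty) (c : ℝ) :
    ∃ R, ∀ x, N.Admissible (N.sinr x.1) x → N.Ψ x ≤ c → ‖x‖ ≤ R := by
  set B := ∑ b, √(N.P b)
  have hcpt : IsCompact (Metric.closedBall (0 : Precoders ℬ 𝒦 L) B) := isCompact_closedBall _ _
  obtain ⟨A, hA⟩ := hcpt.exists_bound_of_continuousOn N.continuous_sinr.continuousOn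
  -- Upper bound for all rates, from the bound A on the SINRs over the ball containing the feasible
  -- precoders.
  set U := N.τ * Real.logb 2 (1 + |A|)
  have hA0 : (1 : ℝ) ≤ 1 + |A| := le_add_of_nonneg_right (abs_nonneg A)
  have hU0 : 0 ≤ U := mul_nonneg N.τ_pos.le (Real.logb_nonneg one_lt_two hA0)
  have hΨ : ∀ x : Precoders ℬ 𝒦 L × Rates 𝒦, N.Ψ x ≤ c → ∀ k,
      |x.2.1 k + x.2.2 k - N.rdes k| ≤ √(c * (Fintype.card 𝒦) / N.α) := by
    intro x hx k
    have hcard : (0 : ℝ) < Fintype.card 𝒦 := by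
      exact_mod_cast Fintype.card_pos_iff.2 ⟨k⟩
    refine Real.le_sqrt_of_sq_le ?_
    rw [le_div_iff₀ hα]
    have h1 : |x.2.1 k + x.2.2 k - N.rdes k| ^ 2 ≤ ∑ k, |x.2.1 k + x.2.2 k - N.rdes k| ^ 2 :=
      Finset.single_le_sum (f := fun k => |x.2.1 k + x.2.2 k - N.rdes k| ^ 2)
        (fun _ _ => sq_nonneg _) (Finset.mem_univ k)
    have h2 : 0 ≤ (1 - N.α) * ∑ k, (∑ b, ‖x.1.1 k b‖ ^ 2 + ∑ b, ‖x.1.2 k b‖ ^ 2) := by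
      have : 0 ≤ 1 - N.α := sub_nonneg.2 N.α_le_one
      positivity
    have h3 : N.α * (1 / (Fintype.card 𝒦 : ℝ)) * ∑ k, |x.2.1 k + x.2.2 k - N.rdes k| ^ 2 ≤ c := by
      unfold Ψ at hx
      linarith
    have h4 : (∑ k, |x.2.1 k + x.2.2 k - N.rdes k| ^ 2) * N.α ≤ c * Fintype.card 𝒦 := by
      rw [← div_le_iff₀ hcard]
      refine le_trans (le_of_eq ?_) h3
      field_simp
    exact (mul_le_mul_of_nonneg_right h1 hα.le).trans h4
  -- The objective bounds each rate gap by G. As both rates of a user are at most U, neither can be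
  -- below -(U + G + D).
  set G := √(c * (Fintype.card 𝒦) / N.α)
  have hG0 : 0 ≤ G := Real.sqrt_nonneg _
  set D := ∑ k, |N.rdes k|
  have hD0 : 0 ≤ D := Finset.sum_nonneg fun _ _ => abs_nonneg _
  have hB0 : 0 ≤ B := Finset.sum_nonneg fun _ _ => Real.sqrt_nonneg _
  refine ⟨B + (U + G + D), fun x hx hxc => ?_⟩
  have hw : ‖x.1‖ ≤ B := N.norm_le_of_txPower_le hx.clustering hx.power
  have hs := hA x.1 (mem_closedBall_zero_iff.2 hw)
  have hup : ∀ a y : ℝ, (2 : ℝ) ^ (y / N.τ) ≤ 1 + a → a ≤ A → y ≤ U := by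
    intro a y h1 h2
    have hpos : 0 < 1 + |A| := one_pos.trans_le hA0
    exact (le_mul_logb_iff N.τ_pos hpos).2 (h1.trans (add_le_add_right (h2.trans (le_abs_self A)) 1))
  have hp : ∀ k, x.2.1 k ≤ U := fun k => by
    refine hup _ _ (hx.rateP k) ((le_abs_self _).trans ?_)
    exact ((norm_le_pi_norm (N.sinr x.1).1 k).trans (norm_fst_le _)).trans hs
  have hc : ∀ i, x.2.2 i ≤ U := fun i => by
    -- A common rate is bounded above only through a user that decodes it.
    obtain ⟨k, hk⟩ := hM i
    refine hup _ _ (hx.rateC k i (by simpa [I] using hk)) ((le_abs_self _).trans ?_)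
    exact (((norm_le_pi_norm ((N.sinr x.1).2 i) k).trans (norm_le_pi_norm (N.sinr x.1).2 i)).trans
      (norm_snd_le _)).trans hs
  have hgap : ∀ k, -G ≤ x.2.1 k + x.2.2 k - N.rdes k := fun k => (abs_le.1 (hΨ x hxc k)).1
  have hdes : ∀ k, -D ≤ N.rdes k := fun k => by
    have := Finset.single_le_sum (f := fun k => |N.rdes k|) (fun _ _ => abs_nonneg _)
      (Finset.mem_univ k)
    have := neg_abs_le (N.rdes k)
    simp only [D]
    linarith
  have hR : 0 ≤ U + G + D := by linarith
  refine norm_prod_le_iff.2 ⟨by linarith, le_trans ?_ (le_add_of_nonneg_left hB0)⟩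
  refine norm_prod_le_iff.2 ⟨(pi_norm_le_iff_of_nonneg hR).2 fun k => ?_,
    (pi_norm_le_iff_of_nonneg hR).2 fun k => ?_⟩
  · rw [Real.norm_eq_abs, abs_le]
    constructor <;> linarith [hp k, hc k, hgap k, hdes k]
  · rw [Real.norm_eq_abs, abs_le]
    constructor <;> linarith [hp k, hc k, hgap k, hdes k]

theorem isCompact_sublevel (N : Network ℬ 𝒦 L) (hα : 0 < N.α) (hM : ∀ i, (N.M i).Nonempty)
    {s : Precoders ℬ 𝒦 L → SinrVars 𝒦} (hs : Continuous s) (hle : ∀ w, s w ≤ N.sinr w) (c : ℝ) :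
    IsCompact {x | N.Admissible (s x.1) x ∧ N.Ψ x ≤ c} := by
  obtain ⟨R, hR⟩ := N.exists_norm_le_of_admissible hα hM c
  refine Metric.isCompact_of_isClosed_isBounded
    ((N.isClosed_admissible hs).inter (isClosed_le N.differentiable_Ψ.continuous continuous_const))
    (isBounded_iff_forall_norm_le.2 ⟨R, fun x hx => hR x (hx.1.mono (hle _)) hx.2⟩)

theorem exists_solvesOpt3 (N : Network ℬ 𝒦 L) (hα : 0 < N.α) (hM : ∀ i, (N.M i).Nonempty)
    {w : Precoders ℬ 𝒦 L} (hw : N.FeasiblePrecoders w) :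
    ∃ w' r' γ', N.SolvesOpt3 (N.auxUpdate w) w' r' γ' := by
  have h0 : N.Admissible (N.qtBound (N.auxUpdate w) w) (w, 0) := by
    rw [qtBound_auxUpdate]
    exact N.admissible_zero hw
  obtain ⟨x, hx, hmin⟩ := (N.isCompact_sublevel hα hM (N.continuous_qtBound (N.auxUpdate w))
    (N.qtBound_le_sinr _) (N.Ψ (w, 0))).exists_isMinOn ⟨(w, 0), h0, le_rfl⟩
    N.differentiable_Ψ.continuous.continuousOn
  refine ⟨x.1, x.2, _, Admissible.opt3Feasible hx.1, fun w' r' γ' h' => ?_⟩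
  -- Minimality is known only on the sublevel set of (w, 0); every other feasible point has a larger
  -- value anyway.
  rcases le_total (N.Ψ (w', r')) (N.Ψ (w, 0)) with h | h
  · exact hmin ⟨h'.admissible, h⟩
  · exact hx.2.trans h

/-! ### Convergence of the algorithm -/

/-- Lowering all rates strictly relaxes the rate constraints. -/
theorem Admissible.eventually_of_lower_rates {N : Network ℬ 𝒦 L} {x : Precoders ℬ 𝒦 L × Rates 𝒦}
    {u : AuxVars 𝒦} (hx : N.Admissible (N.qtBound u x.1) x) {ε : ℝ} (hε : 0 < ε) :
    ∀ᶠ v in 𝓝 u, N.Admissible (N.qtBound v x.1)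
      (x.1, (fun k => x.2.1 k - ε, fun k => x.2.2 k - ε)) := by
  have hlt : ∀ y : ℝ, (2 : ℝ) ^ ((y - ε) / N.τ) < 2 ^ (y / N.τ) := fun y =>
    Real.rpow_lt_rpow_of_exponent_lt one_lt_two
      (div_lt_div_of_pos_right (sub_lt_self y hε) N.τ_pos)
  have hcont := N.continuous_qtBound_left x.1
  have h1 : ∀ᶠ v in 𝓝 u, ∀ k, (2 : ℝ) ^ ((x.2.1 k - ε) / N.τ) < 1 + (N.qtBound v x.1).1 k :=
    eventually_all.2 fun k =>
      (continuous_const.add ((continuous_apply k).comp (continuous_fst.comp hcont))).continuousAt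
        |>.eventually (lt_mem_nhds ((hlt _).trans_le (hx.rateP k)))
  have h2 : ∀ᶠ v in 𝓝 u, ∀ k i, i ∈ N.I k →
      (2 : ℝ) ^ ((x.2.2 i - ε) / N.τ) < 1 + (N.qtBound v x.1).2 i k :=
    eventually_all.2 fun k => eventually_all.2 fun i => eventually_imp_distrib_left.2 fun hi =>
      (continuous_const.add ((continuous_apply k).comp ((continuous_apply i).comp
        (continuous_snd.comp hcont)))).continuousAt
        |>.eventually (lt_mem_nhds ((hlt _).trans_le (hx.rateC k i hi)))
  filter_upwards [h1, h2] with v hv1 hv2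
  refine ⟨hx.clustering, fun b => le_trans ?_ (hx.fronthaul b), hx.power, fun k => (hv1 k).le,
    fun k i hi => (hv2 k i hi).le⟩
  exact add_le_add (Finset.sum_le_sum fun k _ => sub_le_self _ hε.le)
    (Finset.sum_le_sum fun k _ => sub_le_self _ hε.le)

namespace IsRun

variable {N : Network ℬ 𝒦 L} {w : ℕ → Precoders ℬ 𝒦 L} {r : ℕ → Rates 𝒦} {γ : ℕ → SinrVars 𝒦}

theorem admissible (h : N.IsRun w r γ) (n : ℕ) :
    N.Admissible (N.sinr (w (n + 1))) (w (n + 1), r (n + 1)) :=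
  (h.step n).1.admissible.mono (N.qtBound_le_sinr _ _)

/-- The previous iterate competes in the next problem, because the minorant is exact at its
precoders. The indices start at 1 since `r 0` is arbitrary. -/
theorem Ψ_succ_le (h : N.IsRun w r γ) (n : ℕ) :
    N.Ψ (w (n + 2), r (n + 2)) ≤ N.Ψ (w (n + 1), r (n + 1)) :=
  (h.step (n + 1)).le_of_admissible (by
    simp only [qtBound_auxUpdate]
    exact h.admissible n)

theorem antitone_Ψ (h : N.IsRun w r γ) : Antitone fun n => N.Ψ (w (n + 1), r (n + 1)) :=
  antitone_nat_of_succ_le h.Ψ_succ_le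

theorem exists_tendsto_Ψ (h : N.IsRun w r γ) :
    ∃ ψ : ℝ, Tendsto (fun n => N.Ψ (w n, r n)) atTop (𝓝 ψ) :=
  ⟨_, (tendsto_add_atTop_iff_nat 1).1 (tendsto_atTop_ciInf h.antitone_Ψ
    ⟨0, by rintro _ ⟨n, rfl⟩; exact N.Ψ_nonneg _⟩)⟩

theorem isStationaryOpt1_of_mapClusterPt (h : N.IsRun w r γ) {x : Precoders ℬ 𝒦 L × Rates 𝒦}
    (hx : MapClusterPt x atTop fun n => (w n, r n)) : N.IsStationaryOpt1 x := by
  obtain ⟨ψ, hψ⟩ := h.exists_tendsto_Ψ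
  obtain ⟨U, hU, hUx⟩ := mapClusterPt_iff_ultrafilter.1 hx
  have hxψ : N.Ψ x = ψ := tendsto_nhds_unique
    ((N.differentiable_Ψ.continuous.tendsto x).comp hUx) (hψ.mono_left hU)
  have hxadm : N.Admissible (N.sinr x.1) x := by
    refine (N.isClosed_admissible N.continuous_sinr).mem_of_tendsto hUx (hU ?_)
    filter_upwards [eventually_ge_atTop 1] with n hn
    obtain ⟨m, rfl⟩ := Nat.exists_eq_add_of_le' hn
    exact h.admissible m
  refine N.isStationaryOpt1_of_isMinOn hxadm fun y hy => ?_
  have hux : Tendsto (fun n => N.auxUpdate (w n)) U (𝓝 (N.auxUpdate x.1)) :=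
    (N.continuous_auxUpdate.tendsto x.1).comp hUx.fst_nhds
  -- The iterates n + 1 need not converge along U, but their objective values do, since the whole
  -- sequence of values converges.
  have hshift : Tendsto (fun n => N.Ψ (w (n + 1), r (n + 1))) U (𝓝 ψ) :=
    ((tendsto_add_atTop_iff_nat (f := fun n => N.Ψ (w n, r n)) 1).2 hψ).mono_left hU
  let z : ℝ → Precoders ℬ 𝒦 L × Rates 𝒦 := fun ε =>
    (y.1, (fun k => y.2.1 k - ε, fun k => y.2.2 k - ε))
  -- The competitor y itself may be infeasible for the problem solved at step n; with strictly lower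
  -- rates it is feasible for U-almost all n.
  have hlow : ∀ ε : ℝ, 0 < ε → ψ ≤ N.Ψ (z ε) := by
    intro ε hε
    refine le_of_tendsto hshift ?_
    filter_upwards [hux.eventually (hy.eventually_of_lower_rates hε)] with n hn
    exact (h.step n).le_of_admissible (x := z ε) hn
  have hz : Continuous z := by fun_prop
  have hz0 : z 0 = y := by simp [z]
  have hlim : Tendsto (fun ε => N.Ψ (z ε)) (𝓝[>] 0) (𝓝 (N.Ψ (z 0))) :=
    (N.differentiable_Ψ.continuous.comp hz).continuousAt.tendsto.mono_left nhdsWithin_le_nhds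
  rw [hxψ, ← hz0]
  exact ge_of_tendsto hlim (eventually_mem_nhdsWithin.mono fun ε hε => hlow ε hε)

theorem eventually_mem_sublevel (h : N.IsRun w r γ) :
    ∀ᶠ n in atTop, (w n, r n) ∈
      {x | N.Admissible (N.sinr x.1) x ∧ N.Ψ x ≤ N.Ψ (w 1, r 1)} := by
  filter_upwards [eventually_ge_atTop 1] with n hn
  obtain ⟨m, rfl⟩ := Nat.exists_eq_add_of_le' hn
  exact ⟨h.admissible m, h.antitone_Ψ (Nat.zero_le m)⟩

end IsRun

end Network

theorem lemma3 {ℬ 𝒦 : Type*} [Fintype ℬ] [Fintype 𝒦] [DecidableEq 𝒦] {L : ℕ}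
    (N : Network ℬ 𝒦 L) :
    (∀ (w : ℕ → Precoders ℬ 𝒦 L) (r : ℕ → Rates 𝒦) (γ : ℕ → SinrVars 𝒦), N.IsRun w r γ →
      (∀ n, 1 ≤ n → N.Ψ (w (n + 1), r (n + 1)) ≤ N.Ψ (w n, r n)) ∧
      (∃ ψ : ℝ, Tendsto (fun n => N.Ψ (w n, r n)) atTop (𝓝 ψ)) ∧
      (∀ x : Precoders ℬ 𝒦 L × Rates 𝒦,
        MapClusterPt x atTop (fun n => (w n, r n)) → N.IsStationaryOpt1 x)) ∧
    (0 < N.α → (∀ i, (N.M i).Nonempty) →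
      (∀ w : Precoders ℬ 𝒦 L, N.FeasiblePrecoders w →
        ∃ w' r' γ', N.SolvesOpt3 (N.auxUpdate w) w' r' γ') ∧
      (∀ (w : ℕ → Precoders ℬ 𝒦 L) (r : ℕ → Rates 𝒦) (γ : ℕ → SinrVars 𝒦), N.IsRun w r γ →
        (∃ x : Precoders ℬ 𝒦 L × Rates 𝒦,
          N.IsStationaryOpt1 x ∧ MapClusterPt x atTop (fun n => (w n, r n))) ∧
        Tendsto (fun n => Metric.infDist (w n, r n) {x | N.IsStationaryOpt1 x})
          atTop (𝓝 0))) := by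
  refine ⟨fun w r γ h => ⟨fun n hn => ?_, h.exists_tendsto_Ψ, fun x hx =>
    h.isStationaryOpt1_of_mapClusterPt hx⟩, fun hα hM => ⟨fun w hw =>
    N.exists_solvesOpt3 hα hM hw, fun w r γ h => ?_⟩⟩
  · obtain ⟨m, rfl⟩ := Nat.exists_eq_add_of_le' hn
    exact h.Ψ_succ_le m
  · have hK := N.isCompact_sublevel hα hM N.continuous_sinr (fun _ => le_rfl) (N.Ψ (w 1, r 1))
    obtain ⟨x, -, hx⟩ := hK.exists_mapClusterPt_of_frequently h.eventually_mem_sublevel.frequently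
    exact ⟨⟨x, h.isStationaryOpt1_of_mapClusterPt hx, hx⟩,
      hK.tendsto_infDist_zero h.eventually_mem_sublevel fun y hy =>
        h.isStationaryOpt1_of_mapClusterPt hy⟩
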